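/- Let $A$ be a real $n\times n$ matrix. Write $\sigma_*(X)$ for the set of distinct nonzero (complex) eigenvalues of a matrix $X$ and $\mathcal E(z,X)\subseteq\mathbb C^n$ for its generalised eigenspace at $z$. Let $L$ be a limit of real roots of $A$, that is, there are a strictly increasing sequence $(c_i)$ of positive integers and real matrices $B_i$ with $B_i^{c_i}=A$ for all $i$ and $B_i\to L$. Let $M$ be the multiplicity rearrangement matrix for $(A,L)$: the matrix with rows indexed by $\sigma_*(A)$, columns indexed by $\sigma_*(L)$, and entries $M[\lambda,\nu]=\dim_{\mathbb C}\bigl(\mathcal E(\lambda,A)\cap\mathcal E(\nu,L)\bigr)$. Then: 1. If $\lambda\in\sigma_*(A)$ is non-real, then $\bar\lambda\in\sigma_*(A)$, and for every $\nu\in\sigma_*(L)$: if $\nu\in\{1,-1\}$ then $M[\lambda,\nu]=M[\bar\lambda,\nu]$; if $\nu\notin\{1,-1\}$ then $\bar\nu\in\sigma_*(L)$ and $M[\lambda,\nu]=M[\bar\lambda,\bar\nu]$. 2. If $\lambda\in\sigma_*(A)$ is real and $\nu\in\sigma_*(L)$ is non-real, then $\bar\nu\in\sigma_*(L)$ and $M[\lambda,\nu]=M[\lambda,\bar\nu]$.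 3. Let $(c_i)$, $(B_i)$ be any sequences as above with $B_i\to L$. Then infinitely many $c_i$ are even or infinitely many $c_i$ are odd, and moreover: (a) if infinitely many $c_i$ are even, then for every negative eigenvalue $-\lambda'$ of $A$ the entries $M[-\lambda',1]$ and $M[-\lambda',-1]$ are even; (b) if infinitely many $c_i$ are odd, then for every positive eigenvalue $\lambda$ and every negative eigenvalue $-\lambda'$ of $A$ the entries $M[\lambda,-1]$ and $M[-\lambda',1]$ are even. Here statements about an entry in column $\nu=\pm1$ are made when $\nu\in\sigma_*(L)$. In particular, at least one of the following holds: infinitely many $c_i$ are even and the conclusion of (a) is true; or infinitely many $c_i$ are odd and the conclusion of (b) is true. -/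

import Mathlib

open Filter Topology

namespace MatrixRoots

/-- `σ_*(A)`: the set of distinct nonzero eigenvalues of a complex matrix `A`. -/
def sigmaStar {n : ℕ} (A : Matrix (Fin n) (Fin n) ℂ) : Set ℂ :=
  {z | z ≠ 0 ∧ Module.End.HasEigenvalue (Matrix.toLin' A) z}

/-- `𝓔(z, A)`: the generalised eigenspace of `A` for `z`, i.e. the vectors killed by some
power of `A - z`. -/
noncomputable def genEigenspace {n : ℕ} (z : ℂ) (A : Matrix (Fin n) (Fin n) ℂ) :
    Submodule ℂ (Fin n → ℂ) :=
  Module.End.maxGenEigenspace (Matrix.toLin' A) z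

/-- `M_n(ℝ)`, viewed as a subset of `M_n(ℂ)`. -/
def realMatrices (n : ℕ) : Set (Matrix (Fin n) (Fin n) ℂ) :=
  Set.range fun R : Matrix (Fin n) (Fin n) ℝ => R.map Complex.ofReal

/-- `𝓟_S(A)`: the positive integers `c` such that `A` has a `c`-th root in `S`. -/
def rootExponents {n : ℕ} (S : Set (Matrix (Fin n) (Fin n) ℂ))
    (A : Matrix (Fin n) (Fin n) ℂ) : Set ℕ :=
  {c | 0 < c ∧ ∃ B ∈ S, B ^ c = A}

/-- `𝓡_S(A)`: all roots of `A` in `S`. -/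
def roots {n : ℕ} (S : Set (Matrix (Fin n) (Fin n) ℂ))
    (A : Matrix (Fin n) (Fin n) ℂ) : Set (Matrix (Fin n) (Fin n) ℂ) :=
  {B | B ∈ S ∧ ∃ c : ℕ, 0 < c ∧ B ^ c = A}

/-- The exponents `c i` and the roots `B i` exhibit `L` as a limit of `S`-roots of `A`. -/
structure IsRootSequence {n : ℕ} (S : Set (Matrix (Fin n) (Fin n) ℂ))
    (A L : Matrix (Fin n) (Fin n) ℂ) (c : ℕ → ℕ) (B : ℕ → Matrix (Fin n) (Fin n) ℂ) : Prop where
  strictMono : StrictMono c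
  mem_rootExponents : ∀ i, c i ∈ rootExponents S A
  mem_roots : ∀ i, B i ∈ roots S A
  pow_eq : ∀ i, B i ^ c i = A
  tendsto : Tendsto B atTop (𝓝 L)

/-- `𝓛_S(A)`: the set of all limits of `S`-roots of `A`. -/
def limitRoots {n : ℕ} (S : Set (Matrix (Fin n) (Fin n) ℂ))
    (A : Matrix (Fin n) (Fin n) ℂ) : Set (Matrix (Fin n) (Fin n) ℂ) :=
  {L | ∃ c B, IsRootSequence S A L c B}

/-- The multiplicity rearrangement matrix for `(A, L)`: rows are indexed by `σ_*(A)`, columns by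
`σ_*(L)`, and `M[z, w] = dim (𝓔(z, A) ∩ 𝓔(w, L))`. -/
noncomputable def rearrangementMatrix {n : ℕ} (A L : Matrix (Fin n) (Fin n) ℂ) :
    Matrix (sigmaStar A) (sigmaStar L) ℕ :=
  Matrix.of fun z w =>
    Module.finrank ℂ ↥(genEigenspace (z : ℂ) A ⊓ genEigenspace (w : ℂ) L)

end MatrixRoots

open MatrixRoots

/-!
A limit `L` of real roots of a real matrix is real, so entrywise complex conjugation maps
`𝓔(z, A) ∩ 𝓔(w, L)` onto `𝓔(conj z, A) ∩ 𝓔(conj w, L)`.  This gives the symmetry statements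
(`MatrixRoots.finrank_inf_conj`).

For the parity statements, let `z` be a real eigenvalue of `A` and `r = ±1`.  The spectral
projection `P` of `A` at `z` is a real polynomial in `A`, so it commutes with the roots `B i` and
with `L`.  As `r ≠ 0`, the space `𝓔(z, A) ∩ 𝓔(r, L)` is the generalised eigenspace of `L * P` at
`r` (`MatrixRoots.inf_genEigenspace_eq`), so its dimension is the multiplicity of `r` as a root of
the real polynomial `charpoly (L * P)`, the limit of the polynomials `charpoly (B i * P)`.

A real root `x ≠ 0` of `charpoly (B i * P)` satisfies `x ^ c i = z`, which the parity of `c i` and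
the signs of `z` and `r` exclude for `x` on the same side of `0` as `r`.  Hence infinitely many of
the polynomials `charpoly (B i * P)` have constant sign on that half-line, so the limit does not
change sign at `r`, and a real polynomial that does not change sign at a root vanishes there to
even order (`Matrix.even_rootMultiplicity_charpoly_of_tendsto`).  Working with signs avoids any
tracking of the eigenvalues of `B i` as they converge.
-/

open MatrixRoots

open scoped ComplexConjugate Matrix

/-! ### Even multiplicity of a real root under a sign condition -/

/-- A real polynomial that keeps its sign near `r` has `r` as a root of even order: dividing out
`(X - r) ^ m` with `m` odd would leave a factor of opposite signs at `r - t` and `r + t`. -/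
theorem Polynomial.even_rootMultiplicity_of_eval_mul_eval_nonneg {p : Polynomial ℝ} (hp : p ≠ 0)
    {r : ℝ} {s : Set ℝ} (hs : s ∈ 𝓝 r) (h : ∀ x ∈ s, ∀ y ∈ s, 0 ≤ p.eval x * p.eval y) :
    Even (p.rootMultiplicity r) := by
  obtain ⟨q, hq, hdvd⟩ := p.exists_eq_pow_rootMultiplicity_mul_and_not_dvd hp r
  set m := p.rootMultiplicity r
  by_contra hm
  rw [Nat.not_even_iff_odd] at hm
  have hqr : q.eval r ≠ 0 := fun h0 => hdvd (Polynomial.dvd_iff_isRoot.mpr h0)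
  have hlim : Tendsto (fun t : ℝ => q.eval (r - t) * q.eval (r + t)) (𝓝[>] 0)
      (𝓝 (q.eval r * q.eval r)) := by
    have hc : Continuous fun t : ℝ => q.eval (r - t) * q.eval (r + t) := by fun_prop
    have := hc.tendsto 0
    simp only [sub_zero, add_zero] at this
    exact this.mono_left nhdsWithin_le_nhds
  have hsub : ∀ᶠ t : ℝ in 𝓝[>] 0, r - t ∈ s := by
    have hc : Continuous fun t : ℝ => r - t := by fun_prop
    exact nhdsWithin_le_nhds (hc.continuousAt.preimage_mem_nhds (by simpa using hs))
  have hadd : ∀ᶠ t : ℝ in 𝓝[>] 0, r + t ∈ s := by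
    have hc : Continuous fun t : ℝ => r + t := by fun_prop
    exact nhdsWithin_le_nhds (hc.continuousAt.preimage_mem_nhds (by simpa using hs))
  have hle : ∀ᶠ t : ℝ in 𝓝[>] 0, q.eval (r - t) * q.eval (r + t) ≤ 0 := by
    filter_upwards [hsub, hadd, self_mem_nhdsWithin] with t h1 h2 ht
    have hnn := h _ h1 _ h2
    rw [hq] at hnn
    simp only [Polynomial.eval_mul, Polynomial.eval_pow, Polynomial.eval_sub, Polynomial.eval_X,
      Polynomial.eval_C, sub_sub_cancel_left, add_sub_cancel_left, hm.neg_pow] at hnn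
    have htm : 0 < t ^ m * t ^ m := by
      have : 0 < t := ht
      positivity
    by_contra! hcon
    nlinarith [mul_pos htm hcon]
  have h0 : q.eval r * q.eval r ≤ 0 := le_of_tendsto hlim hle
  exact hqr (mul_self_eq_zero.mp (le_antisymm h0 (mul_self_nonneg _)))

theorem Matrix.continuous_eval_charpoly {ι R : Type*} [Fintype ι] [DecidableEq ι] [CommRing R]
    [TopologicalSpace R] [IsTopologicalRing R] (x : R) :
    Continuous fun M : Matrix ι ι R => M.charpoly.eval x := by
  simp only [Matrix.eval_charpoly]
  exact (continuous_const.sub continuous_id).matrix_det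

/-- If infinitely many of the real matrices `C i` have no eigenvalue in an interval around `r`,
their characteristic polynomials have constant sign there, and this passes to the limit. -/
theorem Matrix.even_rootMultiplicity_charpoly_of_tendsto {ι : Type*} [Fintype ι] [DecidableEq ι]
    {C : ℕ → Matrix ι ι ℝ} {D : Matrix ι ι ℝ} (hC : Tendsto C atTop (𝓝 D)) {r : ℝ} {s : Set ℝ}
    (hs : s ∈ 𝓝 r) (hconn : IsPreconnected s)
    (h : ∃ᶠ i in atTop, ∀ x ∈ s, (C i).charpoly.eval x ≠ 0) :
    Even (D.charpoly.rootMultiplicity r) := by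
  refine Polynomial.even_rootMultiplicity_of_eval_mul_eval_nonneg D.charpoly_monic.ne_zero hs
    fun x hx y hy => ?_
  have hlim : Tendsto (fun i => (C i).charpoly.eval x * (C i).charpoly.eval y) atTop
      (𝓝 (D.charpoly.eval x * D.charpoly.eval y)) :=
    (((Matrix.continuous_eval_charpoly x).tendsto D).comp hC).mul
      (((Matrix.continuous_eval_charpoly y).tendsto D).comp hC)
  refine ge_of_tendsto_of_frequently hlim (h.mono fun i hi => ?_)
  by_contra! hneg
  have hcont : ContinuousOn (fun t => (C i).charpoly.eval t) s :=
    (Polynomial.continuous _).continuousOn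
  rcases mul_neg_iff.mp hneg with ⟨hx0, hy0⟩ | ⟨hx0, hy0⟩
  · obtain ⟨t, ht, ht0⟩ := hconn.intermediate_value hy hx hcont ⟨hy0.le, hx0.le⟩
    exact hi t ht ht0
  · obtain ⟨t, ht, ht0⟩ := hconn.intermediate_value hx hy hcont ⟨hx0.le, hy0.le⟩
    exact hi t ht ht0

/-! ### The spectral projection onto a generalised eigenspace -/

/-- The spectral projection of `A` at `z`, obtained from a Bézout identity between
`(X - z) ^ card ι` and the part of the characteristic polynomial prime to `X - z`.  It is a
polynomial in `A`, so it commutes with everything that commutes with `A`. -/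
theorem Matrix.exists_spectralProjection {ι K : Type*} [Fintype ι] [DecidableEq ι] [Field K]
    (A : Matrix ι ι K) (z : K) :
    ∃ P G : Matrix ι ι K, P * P = P ∧ (∀ B, Commute A B → Commute P B) ∧
      (A - z • 1) ^ Fintype.card ι * P = 0 ∧ 1 - P = G * (A - z • 1) ^ Fintype.card ι := by
  have hmN : A.charpoly.rootMultiplicity z ≤ Fintype.card ι := by
    classical
    rw [← A.charpoly_natDegree_eq_dim, ← Polynomial.count_roots]
    exact (Multiset.count_le_card _ _).trans (Polynomial.card_roots' _)
  set N := Fintype.card ι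
  obtain ⟨q, hq, hdvd⟩ :=
    A.charpoly.exists_eq_pow_rootMultiplicity_mul_and_not_dvd A.charpoly_monic.ne_zero z
  set m := A.charpoly.rootMultiplicity z
  have hcop : IsCoprime ((Polynomial.X - Polynomial.C z) ^ N) q :=
    IsCoprime.pow_left
      (((Polynomial.irreducible_X_sub_C z).coprime_iff_not_dvd).mpr hdvd)
  obtain ⟨a, b, hab⟩ := hcop
  have hT : Polynomial.aeval A (Polynomial.X - Polynomial.C z) = A - z • 1 := by
    simp [Algebra.algebraMap_eq_smul_one]
  have hcomp : 1 - Polynomial.aeval A (b * q) = Polynomial.aeval A a * (A - z • 1) ^ N := by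
    rw [← hT, ← map_pow, ← map_mul, ← map_one (Polynomial.aeval (R := K) A), ← map_sub, ← hab]
    congr 1
    ring
  have hkill : (A - z • 1) ^ N * Polynomial.aeval A (b * q) = 0 := by
    rw [← hT, ← map_pow, ← map_mul]
    have : (Polynomial.X - Polynomial.C z) ^ N * (b * q) =
        ((Polynomial.X - Polynomial.C z) ^ (N - m) * b) * A.charpoly := by
      rw [hq, ← Nat.sub_add_cancel hmN, pow_add, Nat.add_sub_cancel]
      ring
    rw [this, map_mul, A.aeval_self_charpoly, mul_zero]
  refine ⟨Polynomial.aeval A (b * q), Polynomial.aeval A a, ?_, fun B hB => ?_, hkill, hcomp⟩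
  · have : (1 - Polynomial.aeval A (b * q)) * Polynomial.aeval A (b * q) = 0 := by
      rw [hcomp, mul_assoc, hkill, mul_zero]
    rw [sub_mul, one_mul, sub_eq_zero] at this
    exact this.symm
  · exact (Polynomial.aeval_eq_sum_range (R := K) (p := b * q) A) ▸
      Commute.sum_left _ _ _ fun k _ => (hB.pow_left k).smul_left _

namespace MatrixRoots

variable {n : ℕ} {A L P : Matrix (Fin n) (Fin n) ℂ} {z w : ℂ} {v : Fin n → ℂ}

theorem mem_genEigenspace_iff : v ∈ genEigenspace z A ↔ ∃ k : ℕ, (A - z • 1) ^ k *ᵥ v = 0 := by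
  have h : Matrix.toLin' A - z • 1 = Matrix.toLin' (A - z • 1) := by
    ext; simp
  rw [genEigenspace, Module.End.mem_maxGenEigenspace, h]
  simp only [← Matrix.toLin'_pow, Matrix.toLin'_apply]

theorem mem_genEigenspace_iff_pow_dim :
    v ∈ genEigenspace z A ↔ (A - z • 1) ^ n *ᵥ v = 0 := by
  have h : Matrix.toLin' A - z • 1 = Matrix.toLin' (A - z • 1) := by
    ext; simp
  rw [genEigenspace, Module.End.maxGenEigenspace_eq_genEigenspace_finrank,
    Module.End.mem_genEigenspace_nat, h, LinearMap.mem_ker]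
  simp only [← Matrix.toLin'_pow, Matrix.toLin'_apply, Module.finrank_fin_fun]

/-- Cutting `L` down by the spectral projection of `A` at `z` turns the intersection with
`𝓔(z, A)` into a single generalised eigenspace, as long as the eigenvalue of `L` is nonzero. -/
theorem inf_genEigenspace_eq (hP : P * P = P) (hLP : Commute P L)
    (hmem : ∀ v, v ∈ genEigenspace z A ↔ P *ᵥ v = v) (hw : w ≠ 0) :
    genEigenspace z A ⊓ genEigenspace w L = genEigenspace w (L * P) := by
  have hcomm : Commute P (L - w • 1) := hLP.sub_right ((Commute.one_right P).smul_right w)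
  have hcommP : Commute P (L * P - w • 1) :=
    (hLP.mul_right (Commute.refl P)).sub_right ((Commute.one_right P).smul_right w)
  -- `L * P - w` acts as `L - w` on the range of `P` and as the invertible scalar `-w` on its kernel.
  have hon : ∀ k : ℕ, (L * P - w • 1) ^ k * P = (L - w • 1) ^ k * P := by
    intro k
    induction k with
    | zero => simp
    | succ k ih =>
      have h1 : (L * P - w • 1) * P = (L - w • 1) * P := by
        rw [sub_mul, sub_mul, mul_assoc, hP]
      rw [pow_succ, mul_assoc, h1, ← hcomm.eq, ← mul_assoc, ih, mul_assoc, hcomm.eq, ← mul_assoc,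
        ← pow_succ]
  have hoff : ∀ k : ℕ, (L * P - w • 1) ^ k * (1 - P) = (-w) ^ k • (1 - P) := by
    intro k
    induction k with
    | zero => simp
    | succ k ih =>
      have h1 : (L * P - w • 1) * (1 - P) = (-w) • (1 - P) := by
        rw [sub_mul, mul_assoc, mul_sub, mul_one, hP, sub_self, mul_zero, zero_sub, smul_mul_assoc,
          one_mul, neg_smul]
      rw [pow_succ, mul_assoc, h1, mul_smul_comm, ih, smul_smul, pow_succ, mul_comm]
  ext v
  rw [Submodule.mem_inf, hmem, mem_genEigenspace_iff, mem_genEigenspace_iff]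
  constructor
  · rintro ⟨hv, k, hk⟩
    refine ⟨k, ?_⟩
    rw [← hv, Matrix.mulVec_mulVec, hon, ← Matrix.mulVec_mulVec, hv, hk]
  · rintro ⟨k, hk⟩
    have hv : P *ᵥ v = v := by
      have h0 : (L * P - w • 1) ^ k *ᵥ ((1 - P) *ᵥ v) = 0 := by
        have hc : Commute (1 - P) ((L * P - w • 1) ^ k) :=
          ((Commute.one_left _).sub_left hcommP).pow_right k
        rw [Matrix.mulVec_mulVec, ← hc.eq, ← Matrix.mulVec_mulVec, hk, Matrix.mulVec_zero]
      rw [Matrix.mulVec_mulVec, hoff, Matrix.smul_mulVec] at h0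
      have h1 := (smul_eq_zero.mp h0).resolve_left (pow_ne_zero k (neg_ne_zero.mpr hw))
      rw [Matrix.sub_mulVec, Matrix.one_mulVec, sub_eq_zero] at h1
      exact h1.symm
    refine ⟨hv, k, ?_⟩
    rw [← hv, Matrix.mulVec_mulVec, ← hon, ← Matrix.mulVec_mulVec, hv, hk]

theorem finrank_genEigenspace (A : Matrix (Fin n) (Fin n) ℂ) (z : ℂ) :
    Module.finrank ℂ (genEigenspace z A) = A.charpoly.rootMultiplicity z := by
  rw [genEigenspace, LinearMap.finrank_maxGenEigenspace_eq, Matrix.charpoly_toLin']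

/-! ### Parity of the entries in the columns `1` and `-1` -/

/-- `dim (𝓔(z, A) ∩ 𝓔(r, L))` is even when, for infinitely many `i`, no real `x` on the same side
of `0` as `r` satisfies `x ^ c i = z`.  The roots are multiplied by the spectral projection of `A`
at `z`, so that such `x` are the only candidates for real eigenvalues near `r`. -/
theorem even_finrank_inf_of_tendsto {A L : Matrix (Fin n) (Fin n) ℝ} {c : ℕ → ℕ}
    {B : ℕ → Matrix (Fin n) (Fin n) ℝ} (hpow : ∀ i, B i ^ c i = A)
    (hB : Tendsto B atTop (𝓝 L)) {z r : ℝ} (hr : r ≠ 0)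
    (h : ∃ᶠ i in atTop, ∀ x : ℝ, 0 < x * r → x ^ c i ≠ z) :
    Even (Module.finrank ℂ ↥(genEigenspace (z : ℂ) (A.map Complex.ofReal) ⊓
      genEigenspace (r : ℂ) (L.map Complex.ofReal))) := by
  obtain ⟨P, G, hPP, hPcomm, hAP, hPG⟩ := A.exists_spectralProjection z
  rw [Fintype.card_fin] at hAP hPG
  have hPB : ∀ i, Commute P (B i) := fun i => hPcomm _ (hpow i ▸ Commute.pow_self (B i) (c i))
  have hPL : Commute P L :=
    tendsto_nhds_unique (tendsto_const_nhds.mul hB)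
      ((hB.mul tendsto_const_nhds).congr fun i => ((hPB i).eq).symm)
  let Φ : Matrix (Fin n) (Fin n) ℝ →+* Matrix (Fin n) (Fin n) ℂ := Complex.ofRealHom.mapMatrix
  have hΦ : ∀ M, Φ M = M.map Complex.ofReal := fun M => rfl
  have hΦA : Φ (A - z • 1) = Φ A - (z : ℂ) • 1 := by
    rw [map_sub]
    congr 1
    ext i j
    rcases eq_or_ne i j with rfl | hij <;> simp [Φ, *]
  have hmem : ∀ v, v ∈ genEigenspace (z : ℂ) (Φ A) ↔ Φ P *ᵥ v = v := by
    intro v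
    rw [mem_genEigenspace_iff_pow_dim, ← hΦA, ← map_pow]
    constructor
    · intro hv
      have : Φ (1 - P) *ᵥ v = 0 := by
        rw [hPG, map_mul, ← Matrix.mulVec_mulVec, hv, Matrix.mulVec_zero]
      rw [map_sub, map_one, Matrix.sub_mulVec, Matrix.one_mulVec, sub_eq_zero] at this
      exact this.symm
    · intro hv
      rw [← hv, Matrix.mulVec_mulVec, ← map_mul, hAP, map_zero, Matrix.zero_mulVec]
  rw [← hΦ, ← hΦ, inf_genEigenspace_eq (by rw [← map_mul, hPP]) (hPL.map Φ) hmem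
    (by exact_mod_cast hr), ← map_mul, finrank_genEigenspace, hΦ]
  have hchar : ((L * P).map Complex.ofReal).charpoly =
      (L * P).charpoly.map Complex.ofRealHom := Matrix.charpoly_map _ Complex.ofRealHom
  have hroot := Polynomial.eq_rootMultiplicity_map (p := (L * P).charpoly)
    (f := Complex.ofRealHom) Complex.ofRealHom.injective r
  rw [hchar]
  refine hroot ▸ ?_
  refine Matrix.even_rootMultiplicity_charpoly_of_tendsto (s := {x | 0 < x * r})
    (hB.mul_const P) ?_ ?_ (h.mono fun i hi x hx h0 => ?_)
  · have ho : IsOpen {x : ℝ | 0 < x * r} := isOpen_lt continuous_const (by fun_prop)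
    exact ho.mem_nhds (mul_self_pos.mpr hr)
  · refine Convex.isPreconnected fun x hx y hy a b ha hb hab => ?_
    simp only [Set.mem_ofPred_eq, smul_eq_mul] at hx hy ⊢
    rcases ha.eq_or_lt with rfl | ha
    · simpa [show b = 1 by linarith] using hy
    · nlinarith [mul_pos ha hx, mul_nonneg hb hy.le]
  -- An eigenvector of `B i * P` for `x ≠ 0` lies in the range of `P`, hence in the generalised
  -- eigenspace of `A` at `z`, and it is an eigenvector of `A = B i ^ c i` for `x ^ c i`.
  · have hx0 : x ≠ 0 := fun h => by simp [h] at hx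
    rw [Matrix.eval_charpoly] at h0
    obtain ⟨v, hv0, hv⟩ := Matrix.exists_mulVec_eq_zero_iff.mpr h0
    have hBPv : (B i * P) *ᵥ v = x • v := by
      rw [Matrix.sub_mulVec, sub_eq_zero, Matrix.scalar_apply, ← Matrix.smul_one_eq_diagonal,
        Matrix.smul_mulVec, Matrix.one_mulVec] at hv
      exact hv.symm
    have hPv : P *ᵥ v = v := by
      have : P *ᵥ (x • v) = x • v := by
        rw [← hBPv, Matrix.mulVec_mulVec, ← mul_assoc, (hPB i).eq, mul_assoc, hPP]
      rw [Matrix.mulVec_smul] at this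
      exact smul_right_injective _ hx0 this
    have hBv : B i *ᵥ v = x • v := by
      rw [← hBPv, ← Matrix.mulVec_mulVec, hPv]
    have hBk : ∀ k : ℕ, B i ^ k *ᵥ v = x ^ k • v := by
      intro k
      induction k with
      | zero => simp
      | succ k ih =>
        rw [pow_succ, ← Matrix.mulVec_mulVec, hBv, Matrix.mulVec_smul, ih, smul_smul, pow_succ,
          mul_comm]
    have hAv : (A - z • 1) *ᵥ v = (x ^ c i - z) • v := by
      rw [Matrix.sub_mulVec, ← hpow i, hBk, Matrix.smul_mulVec, Matrix.one_mulVec, sub_smul]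
    have hAk : ∀ k : ℕ, (A - z • 1) ^ k *ᵥ v = (x ^ c i - z) ^ k • v := by
      intro k
      induction k with
      | zero => simp
      | succ k ih =>
        rw [pow_succ, ← Matrix.mulVec_mulVec, hAv, Matrix.mulVec_smul, ih, smul_smul, pow_succ,
          mul_comm]
    have hz : (x ^ c i - z) ^ n • v = 0 := by
      rw [← hAk, ← hPv, Matrix.mulVec_mulVec, hAP, Matrix.zero_mulVec]
    exact hi x hx (sub_eq_zero.mp (eq_zero_of_pow_eq_zero ((smul_eq_zero.mp hz).resolve_right hv0)))

/-! ### Complex conjugation -/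

theorem map_conj_of_mem_realMatrices (hA : A ∈ realMatrices n) : A.map conj = A := by
  obtain ⟨R, rfl⟩ := hA
  ext i j
  simp

theorem isClosed_realMatrices (n : ℕ) : IsClosed (realMatrices n) := by
  have : realMatrices n = {A | A.map conj = A} := by
    ext A
    refine ⟨map_conj_of_mem_realMatrices, fun hA => ⟨A.map Complex.re, ?_⟩⟩
    ext i j
    exact Complex.conj_eq_iff_re.mp (congrFun (congrFun hA i) j)
  rw [this]
  exact isClosed_eq (continuous_id.matrix_map Complex.continuous_conj) continuous_id

theorem map_conj_sub_smul_pow_mulVec (hA : A ∈ realMatrices n) (z : ℂ) (k : ℕ) (v : Fin n → ℂ) :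
    (A - conj z • 1) ^ k *ᵥ star v = star ((A - z • 1) ^ k *ᵥ v) := by
  have h : A - conj z • 1 = (starRingEnd ℂ).mapMatrix (A - z • 1) := by
    rw [map_sub, RingHom.mapMatrix_apply, map_conj_of_mem_realMatrices hA]
    congr 1
    ext i j
    rcases eq_or_ne i j with rfl | hij <;> simp [*]
  rw [h, ← map_pow]
  ext i
  exact (RingHom.map_mulVec (starRingEnd ℂ) ((A - z • 1) ^ k) v i).symm

theorem star_mem_genEigenspace (hA : A ∈ realMatrices n) (hv : v ∈ genEigenspace z A) :
    star v ∈ genEigenspace (conj z) A := by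
  rw [mem_genEigenspace_iff] at hv ⊢
  obtain ⟨k, hk⟩ := hv
  exact ⟨k, by rw [map_conj_sub_smul_pow_mulVec hA, hk, star_zero]⟩

theorem conj_mem_sigmaStar (hA : A ∈ realMatrices n) (hz : z ∈ sigmaStar A) :
    conj z ∈ sigmaStar A := by
  obtain ⟨hz0, hz⟩ := hz
  refine ⟨by simpa using hz0, ?_⟩
  obtain ⟨v, hv, hv0⟩ := hz.exists_hasEigenvector
  refine Module.End.hasEigenvalue_of_hasEigenvector (x := star v) ⟨?_, by simpa using hv0⟩
  rw [Module.End.mem_eigenspace_iff, Matrix.toLin'_apply] at hv ⊢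
  have h := map_conj_sub_smul_pow_mulVec hA z 1 v
  rw [pow_one, pow_one, Matrix.sub_mulVec, Matrix.sub_mulVec, hv, Matrix.smul_mulVec,
    Matrix.smul_mulVec, Matrix.one_mulVec, Matrix.one_mulVec, sub_self, star_zero] at h
  exact sub_eq_zero.mp h

/-- Entrywise conjugation is a conjugate-linear bijection between the two intersections, so it
preserves dimensions. -/
theorem finrank_inf_conj (hA : A ∈ realMatrices n) (hL : L ∈ realMatrices n) (z w : ℂ) :
    Module.finrank ℂ ↥(genEigenspace z A ⊓ genEigenspace w L) =
      Module.finrank ℂ ↥(genEigenspace (conj z) A ⊓ genEigenspace (conj w) L) := by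
  have hmaps : ∀ z w v, v ∈ genEigenspace z A ⊓ genEigenspace w L →
      star v ∈ genEigenspace (conj z) A ⊓ genEigenspace (conj w) L := fun z w v hv =>
    ⟨star_mem_genEigenspace hA hv.1, star_mem_genEigenspace hL hv.2⟩
  let j : ↥(genEigenspace z A ⊓ genEigenspace w L) ≃+
      ↥(genEigenspace (conj z) A ⊓ genEigenspace (conj w) L) :=
    { toFun := fun v => ⟨star v.1, hmaps z w v.1 v.2⟩
      invFun := fun v => ⟨star v.1, by simpa using hmaps (conj z) (conj w) v.1 v.2⟩
      left_inv := fun v => by simp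
      right_inv := fun v => by simp
      map_add' := fun v u => by ext; simp }
  refine congrArg Cardinal.toNat (rank_eq_of_equiv_equiv (starRingEnd ℂ) j
    (star_involutive.bijective) fun a v => ?_)
  ext
  simp [j]

/-! ### Sequences of exponents -/

theorem frequently_of_infinite_range_inter {c : ℕ → ℕ} {p : ℕ → Prop}
    (h : (Set.range c ∩ {m | p m}).Infinite) : ∃ᶠ i in atTop, p (c i) := by
  rw [Nat.frequently_atTop_iff_infinite]
  intro hfin
  refine h ((hfin.image c).subset ?_)
  rintro _ ⟨⟨i, rfl⟩, hi⟩
  exact ⟨i, hi, rfl⟩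

end MatrixRoots

open ComplexConjugate in
theorem mainTheorem8 (n : ℕ) (A L : Matrix (Fin n) (Fin n) ℂ)
    (hA : A ∈ realMatrices n) (hL : L ∈ limitRoots (realMatrices n) A) :
    -- nonreal eigenvalues of `A`
    (∀ lam : sigmaStar A, (lam : ℂ).im ≠ 0 →
      ∃ lam' : sigmaStar A, (lam' : ℂ) = conj (lam : ℂ) ∧
        ∀ nu : sigmaStar L,
          (((nu : ℂ) = 1 ∨ (nu : ℂ) = -1) →
            rearrangementMatrix A L lam nu = rearrangementMatrix A L lam' nu) ∧
          (¬ ((nu : ℂ) = 1 ∨ (nu : ℂ) = -1) →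
            ∃ nu' : sigmaStar L, (nu' : ℂ) = conj (nu : ℂ) ∧
              rearrangementMatrix A L lam nu = rearrangementMatrix A L lam' nu')) ∧
    -- real eigenvalues of `A`, nonreal eigenvalues of `L`
    (∀ (lam : sigmaStar A) (nu : sigmaStar L), (lam : ℂ).im = 0 → (nu : ℂ).im ≠ 0 →
      ∃ nu' : sigmaStar L, (nu' : ℂ) = conj (nu : ℂ) ∧
        rearrangementMatrix A L lam nu = rearrangementMatrix A L lam nu') ∧
    -- parity, for every sequence of real roots of `A` that converges to `L`
    (∀ (c : ℕ → ℕ) (B : ℕ → Matrix (Fin n) (Fin n) ℂ),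
      IsRootSequence (realMatrices n) A L c B →
      ((Set.range c ∩ {m | Even m}).Infinite ∨ (Set.range c ∩ {m | Odd m}).Infinite) ∧
      ((Set.range c ∩ {m | Even m}).Infinite →
        ∀ (lam : sigmaStar A) (nu : sigmaStar L), (lam : ℂ).im = 0 → (lam : ℂ).re < 0 →
          ((nu : ℂ) = 1 ∨ (nu : ℂ) = -1) → Even (rearrangementMatrix A L lam nu)) ∧
      ((Set.range c ∩ {m | Odd m}).Infinite →
        (∀ (lam : sigmaStar A) (nu : sigmaStar L), (lam : ℂ).im = 0 → 0 < (lam : ℂ).re →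
          (nu : ℂ) = -1 → Even (rearrangementMatrix A L lam nu)) ∧
        (∀ (lam : sigmaStar A) (nu : sigmaStar L), (lam : ℂ).im = 0 → (lam : ℂ).re < 0 →
          (nu : ℂ) = 1 → Even (rearrangementMatrix A L lam nu)))) := by
  obtain ⟨c₀, B₀, h₀⟩ := hL
  have hLreal : L ∈ realMatrices n :=
    (isClosed_realMatrices n).mem_of_tendsto h₀.tendsto
      (Eventually.of_forall fun i => (h₀.mem_roots i).1)
  have hentry : ∀ (lam lam' : sigmaStar A) (nu nu' : sigmaStar L), (lam' : ℂ) = conj (lam : ℂ) →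
      (nu' : ℂ) = conj (nu : ℂ) →
      rearrangementMatrix A L lam nu = rearrangementMatrix A L lam' nu' := by
    intro lam lam' nu nu' h1 h2
    simp only [rearrangementMatrix, Matrix.of_apply]
    rw [h1, h2]
    exact finrank_inf_conj hA hLreal _ _
  refine ⟨fun lam _ => ⟨⟨_, conj_mem_sigmaStar hA lam.2⟩, rfl,
      fun nu => ⟨fun hnu => ?_, fun _ => ?_⟩⟩,
    fun lam nu hlam _ => ?_, fun c B hcB => ?_⟩
  · refine hentry _ _ _ _ rfl ?_
    rcases hnu with h | h <;> simp [h]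
  · exact ⟨⟨_, conj_mem_sigmaStar hLreal nu.2⟩, rfl, hentry _ _ _ _ rfl rfl⟩
  · exact ⟨⟨_, conj_mem_sigmaStar hLreal nu.2⟩, rfl,
      hentry _ _ _ _ (Complex.conj_eq_iff_im.mpr hlam).symm rfl⟩
  obtain ⟨A', rfl⟩ := hA
  obtain ⟨L', rfl⟩ := hLreal
  choose B' hB' using fun i => (hcB.mem_roots i).1
  obtain rfl : (fun i => (B' i).map Complex.ofReal) = B := funext hB'
  have hinj : Function.Injective (Complex.ofRealHom.mapMatrix (m := Fin n)) :=
    fun X Y h => Matrix.map_injective Complex.ofReal_injective h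
  have hpow : ∀ i, B' i ^ c i = A' := fun i =>
    hinj (by rw [map_pow]; exact hcB.pow_eq i)
  have hlim : Tendsto B' atTop (𝓝 L') := by
    have h := ((continuous_id.matrix_map Complex.continuous_re).tendsto _).comp hcB.tendsto
    simpa [Function.comp_def, Matrix.map_map] using h
  have key : ∀ (lam : sigmaStar (A'.map Complex.ofReal)) (nu : sigmaStar (L'.map Complex.ofReal))
      (r : ℝ), (lam : ℂ).im = 0 → (nu : ℂ) = r → r ≠ 0 →
      (∃ᶠ i in atTop, ∀ x : ℝ, 0 < x * r → x ^ c i ≠ (lam : ℂ).re) →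
      Even (rearrangementMatrix (A'.map Complex.ofReal) (L'.map Complex.ofReal) lam nu) := by
    intro lam nu r hlam hnu hr h
    have hz : (lam : ℂ) = ((lam : ℂ).re : ℂ) :=
      (Complex.conj_eq_iff_re.mp (Complex.conj_eq_iff_im.mpr hlam)).symm
    simp only [rearrangementMatrix, Matrix.of_apply]
    rw [hz, hnu]
    exact even_finrank_inf_of_tendsto hpow hlim hr h
  refine ⟨?_, fun hev lam nu him hre hnu => ?_, fun hodd =>
    ⟨fun lam nu him hre hnu => ?_, fun lam nu him hre hnu => ?_⟩⟩
  · rw [← Set.infinite_union, ← Set.inter_union_distrib_left]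
    have : {m : ℕ | Even m} ∪ {m | Odd m} = Set.univ :=
      Set.eq_univ_of_forall Nat.even_or_odd
    rw [this, Set.inter_univ]
    exact Set.infinite_range_of_injective hcB.strictMono.injective
  -- An even power of a real number is not negative.
  · have hfr := (frequently_of_infinite_range_inter hev).mono fun i hi (x : ℝ) =>
      (hre.trans_le (hi.pow_nonneg x)).ne'
    rcases hnu with hnu | hnu
    · exact key lam nu 1 him (by simpa using hnu) one_ne_zero (hfr.mono fun i hi x _ => hi x)
    · exact key lam nu (-1) him (by simpa using hnu) (by norm_num)
        (hfr.mono fun i hi x _ => hi x)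
  -- An odd power of a real number has the sign of its base.
  · refine key lam nu (-1) him (by simpa using hnu) (by norm_num)
      ((frequently_of_infinite_range_inter hodd).mono fun i hi x hx => ?_)
    exact ((hi.pow_neg (by linarith)).trans hre).ne
  · refine key lam nu 1 him (by simpa using hnu) one_ne_zero
      ((frequently_of_infinite_range_inter hodd).mono fun i hi x hx => ?_)
    exact (hre.trans (pow_pos (by linarith) _)).ne'
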